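/- For integers $n\ge 0$ and $k_0,k_T\ge 0$ let $m=k_0+k_T$ and consider the following randomized algorithm, which builds an $m\times n$ matrix $G$ over $\mathbb F_2$ row by row. Given the rows $g_1,\dots,g_{j-1}$, the row $g_j\in\mathbb F_2^n$ is drawn uniformly at random among all vectors satisfying (i) $\sum_{i} g_{a,i}\,g_{j,i}=0$ for all $a<j$; (ii) $\sum_{i} g_{a,i}\,g_{b,i}\,g_{j,i}=0$ for all $a<b<j$; (iii) $\sum_i g_{j,i}=1$ if $j\le k_T$ and $\sum_i g_{j,i}=0$ if $j>k_T$ (all sums in $\mathbb F_2$). If no such vector exists the algorithm fails; if all $m$ rows can be chosen it succeeds and returns $G$. A returned matrix is triorthogonal: distinct rows have pairwise inner product $0$, any three distinct rows have triple product sum $0$, the first $k_T$ rows have odd weight and the other $k_0$ rows have even weight. Let $\mathcal G$ be the span of all rows of $G$, let $\mathcal G_0$ be the span of its even-weight rows, and let $\perp$ denote the dual code in $\mathbb F_2^n$. The distance $d$ of $G$ is the minimum Hamming weight of a vector $u\in\mathcal G_0^\perp$ with $u\notin\mathcal G^\perp$, and the distillation efficiency is $\gamma=\log(n/k_T)/\log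 d$. **Theorem.** There are choices $m=m(n)$, $k_0=k_0(n)$, $k_T=k_T(n)$ with $m=k_0+k_T$ and $m=\Theta(\sqrt n)$, $k_0=\Theta(\sqrt n)$, $k_T=\Theta(\sqrt n)$ as $n\to\infty$, and a constant $C>0$, such that with probability $1-o(1)$ the algorithm succeeds and the resulting triorthogonal matrix $G$ has distance $$d\ \ge\ C\,\frac{\sqrt n}{\log n},$$ and, moreover, $\gamma\to 1$ in probability: for every $\varepsilon>0$, with probability tending to $1$ as $n\to\infty$, the algorithm succeeds, $G$ satisfies this distance bound, and $|\gamma-1|<\varepsilon$. -/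

import Mathlib

open Filter Topology Asymptotics
open scoped ENNReal Matrix

namespace RandTri

/-- Binary words of length `n`, i.e. vectors of `𝔽₂ⁿ`. -/
abbrev Word (n : ℕ) := Fin n → ZMod 2

/-- A binary `m`-by-`n` matrix is triorthogonal, with its first `kT` rows of odd weight and the
remaining ones of even weight (rows are numbered from `0`). -/
structure IsTriorthogonal {m n : ℕ} (kT : ℕ) (G : Matrix (Fin m) (Fin n) (ZMod 2)) : Prop where
  pairs : ∀ a b : Fin m, a < b → ∑ i, G a i * G b i = 0
  triples : ∀ a b c : Fin m, a < b → b < c → ∑ i, G a i * G b i * G c i = 0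
  odd : ∀ a : Fin m, (a : ℕ) < kT → ∑ i, G a i = 1
  even : ∀ a : Fin m, kT ≤ (a : ℕ) → ∑ i, G a i = 0

/-- The span `𝒢` of all the rows. -/
def rowSpan {m n : ℕ} (G : Matrix (Fin m) (Fin n) (ZMod 2)) : Submodule (ZMod 2) (Word n) :=
  Submodule.span (ZMod 2) (Set.range fun a => G a)

/-- The span `𝒢₀` of the rows of even weight. -/
def evenRowSpan {m n : ℕ} (G : Matrix (Fin m) (Fin n) (ZMod 2)) : Submodule (ZMod 2) (Word n) :=
  Submodule.span (ZMod 2) {v | ∃ a, v = G a ∧ Even (hammingNorm (G a))}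

/-- The dual code `𝒞^⊥`. -/
def dualCode {n : ℕ} (C : Submodule (ZMod 2) (Word n)) : Submodule (ZMod 2) (Word n) where
  carrier := {v | ∀ u ∈ C, v ⬝ᵥ u = 0}
  zero_mem' := fun u _ => zero_dotProduct u
  add_mem' := fun {v w} hv hw u hu => by rw [add_dotProduct, hv u hu, hw u hu, add_zero]
  smul_mem' := fun c v hv u hu => by rw [smul_dotProduct, hv u hu, smul_zero]

/-- The distance of a triorthogonal matrix: the minimum Hamming weight of a word of `𝒢₀^⊥`
that is not in `𝒢^⊥` (the value is `0` if there is no such word). -/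
noncomputable def distance {m n : ℕ} (G : Matrix (Fin m) (Fin n) (ZMod 2)) : ℕ :=
  sInf {w | ∃ u : Word n, u ∈ dualCode (evenRowSpan G) ∧ u ∉ dualCode (rowSpan G) ∧
    hammingNorm u = w}

/-- The distillation efficiency `γ = log (n / kT) / log d`. -/
noncomputable def efficiency (n kT d : ℕ) : ℝ :=
  Real.log ((n : ℝ) / (kT : ℝ)) / Real.log (d : ℝ)

/-- The words that may be chosen as the next row when the rows `g 0, …, g (j - 1)` have already
been chosen: orthogonal to all of these and to all their pairwise entrywise products, and of odd
weight if the new row (number `j`, counting from `0`) is among the first `kT`, of even weight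
otherwise. -/
def admissibleRows {n j : ℕ} (kT : ℕ) (g : Matrix (Fin j) (Fin n) (ZMod 2)) : Finset (Word n) :=
  {v | (∀ a, ∑ i, g a i * v i = 0) ∧
    (∀ a b, a < b → ∑ i, g a i * g b i * v i = 0) ∧
    ∑ i, v i = if j < kT then 1 else 0}

/-- The random choice of the next row: uniform among the admissible words, and failure (`none`) if
there is none. -/
noncomputable def nextRow {n j : ℕ} (kT : ℕ) (g : Matrix (Fin j) (Fin n) (ZMod 2)) :
    PMF (Option (Word n)) :=
  if h : (admissibleRows kT g).Nonempty then
    (PMF.uniformOfFinset (admissibleRows kT g) h).map some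
  else PMF.pure none

/-- Append the row `v` at the bottom of the matrix `g`. -/
def appendRow {n j : ℕ} (g : Matrix (Fin j) (Fin n) (ZMod 2)) (v : Word n) :
    Matrix (Fin (j + 1)) (Fin n) (ZMod 2) :=
  Fin.snoc (α := fun _ => Word n) g v

theorem appendRow_last {n j : ℕ} (g : Matrix (Fin j) (Fin n) (ZMod 2)) (v : Word n) :
    appendRow g v (Fin.last j) = v :=
  Fin.snoc_last (α := fun _ => Word n) v g

theorem appendRow_castSucc {n j : ℕ} (g : Matrix (Fin j) (Fin n) (ZMod 2)) (v : Word n)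
    (a : Fin j) : appendRow g v a.castSucc = g a :=
  Fin.snoc_castSucc (α := fun _ => Word n) v g a

/-- One step of the algorithm, from the outcome of the first `j` steps: a failure stays a failure,
otherwise a next row is drawn and appended. -/
noncomputable def step {n j : ℕ} (kT : ℕ) :
    Option (Matrix (Fin j) (Fin n) (ZMod 2)) →
      PMF (Option (Matrix (Fin (j + 1)) (Fin n) (ZMod 2)))
  | none => PMF.pure none
  | some g => (nextRow kT g).map (Option.map (appendRow g))

/-- The law of the outcome of the randomized row-by-row algorithm after `m` rows: `some G` if it
succeeds and returns `G`, `none` if it fails. -/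
noncomputable def algorithm (n kT : ℕ) :
    (m : ℕ) → PMF (Option (Matrix (Fin m) (Fin n) (ZMod 2)))
  | 0 => PMF.pure (some fun a => a.elim0)
  | m + 1 => (algorithm n kT m).bind (step kT)

end RandTri

namespace RandTri

/-! Take `k₀ = kT = k` with `k` about `√n / 16`. A new row is constrained only by the span of the
products of two earlier rows, together with a parity condition. With `j ≤ 2k` earlier rows this is
at most `j² + 1` linear equations, so at least `2 ^ (n - j² - 1)` words are admissible unless the
parity condition contradicts the others.

Genericity excludes that contradiction and is preserved with high probability. If nonzero words `z`
in the span of the rows and `1` weigh more than `t = n / 8`, then `v * z` determines more than `t`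
bits of `v`. Few `v` therefore make a new product combination `v * z` fall near the old product
span. The bad choices number about `2 ^ (n - t + j² + O(k))`, a negligible share of the admissible
ones because `t ≥ 32k²` (`four_pow_mul_card_badRows_le`).

A nonzero word `u` of weight at most `d` then stays outside the product span, so each even row is
orthogonal to `u` with probability at most `1/2`, and all `k` of them with probability at most `2 ^
(-k)`. For `d` of order `k / log n` there are only `O(2 ^ (k / 2))` such words, and a union bound
gives distance greater than `d`.

Conversely the distance is at most `2k` (`IsTriorthogonal.distance_le`). Hence both `log (n / k)`
and the logarithm of the distance are `(1/2) log n` up to `O(log log n)`, and `γ → 1`. -/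

theorem zmod_two_eq (c : ZMod 2) : c = 0 ∨ c = 1 := by
  revert c; decide

theorem word_add_self {n : ℕ} (v : Word n) : v + v = 0 := by
  funext i; exact CharTwo.add_self_eq_zero (v i)

theorem zmod_two_mul_self (c : ZMod 2) : c * c = c := by
  revert c; decide

theorem word_mul_self {n : ℕ} (v : Word n) : v * v = v :=
  funext fun i => zmod_two_mul_self (v i)

/-! ### Hamming balls -/

/-- The words of Hamming weight at most `t`. -/
def ball (n t : ℕ) : Finset (Word n) := {v | hammingNorm v ≤ t}

theorem mem_ball {n t : ℕ} {v : Word n} : v ∈ ball n t ↔ hammingNorm v ≤ t := by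
  simp [ball]

theorem card_filter_eq_zero {n : ℕ} (v : Word n) :
    (Finset.univ.filter fun i => v i = 0).card = n - hammingNorm v := by
  have h := Finset.card_filter_add_card_filter_not (s := Finset.univ) (fun i => v i = 0)
  rw [Finset.card_univ, Fintype.card_fin] at h
  rw [hammingNorm]
  simp only [ne_eq] at *
  omega

theorem sum_pow_sub_hammingNorm (n q : ℕ) :
    ∑ v : Word n, q ^ (n - hammingNorm v) = (q + 1) ^ n := by
  have h (v : Word n) : q ^ (n - hammingNorm v) = ∏ i, if v i = 0 then q else 1 := by
    rw [Finset.prod_ite, Finset.prod_const, Finset.prod_const_one, mul_one, card_filter_eq_zero]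
  simp_rw [h]
  rw [← Fintype.prod_sum (fun (_ : Fin n) (c : ZMod 2) => if c = 0 then q else 1)]
  have h2 : ∑ c : ZMod 2, (if c = 0 then q else 1) = q + 1 := by
    rw [show (Finset.univ : Finset (ZMod 2)) = {0, 1} from rfl, Finset.sum_pair (by decide)]
    simp
  simp [h2]

/-- Chernoff-type bound: each word of the ball contributes at least `q ^ (n - t)` to the weight
enumerator, whose total is `(q + 1) ^ n`. -/
theorem card_ball_mul_pow_le (n t q : ℕ) (hq : 0 < q) :
    (ball n t).card * q ^ n ≤ (q + 1) ^ n * q ^ t := by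
  rw [← sum_pow_sub_hammingNorm, Finset.sum_mul, ← smul_eq_mul, ← Finset.sum_const]
  refine (Finset.sum_le_sum fun v hv => ?_).trans
    (Finset.sum_le_sum_of_subset (Finset.subset_univ (ball n t)))
  rw [← pow_add]
  have := mem_ball.1 hv
  exact Nat.pow_le_pow_right hq (by omega)

/-- Take `q = 4` and square: `5² ≤ 2⁵` leaves the exponent `n + 4t`, which is at most `2(n - t)`
exactly when `6t ≤ n`. -/
theorem card_ball_le_two_pow {n t : ℕ} (h : 6 * t ≤ n) : (ball n t).card ≤ 2 ^ (n - t) := by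
  have h1 := Nat.pow_le_pow_left (card_ball_mul_pow_le n t 4 (by norm_num)) 2
  have h2 : ((4 + 1) ^ n * 4 ^ t) ^ 2 ≤ 2 ^ (5 * n) * 2 ^ (4 * t) := by
    rw [mul_pow, ← pow_mul, mul_comm n 2, pow_mul, pow_mul 2 5]
    refine Nat.mul_le_mul (Nat.pow_le_pow_left (by norm_num) n) (le_of_eq ?_)
    rw [← pow_mul, show (4 : ℕ) = 2 ^ 2 from rfl, ← pow_mul]
    congr 1; ring
  have h3 : (4 ^ n) ^ 2 = 2 ^ (4 * n) := by
    rw [show (4 : ℕ) = 2 ^ 2 from rfl, ← pow_mul, ← pow_mul]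
    congr 1; ring
  have h4 : (ball n t).card ^ 2 * 2 ^ (4 * n) ≤ (2 ^ (n - t)) ^ 2 * 2 ^ (4 * n) := by
    rw [← h3, ← mul_pow]
    refine (h1.trans h2).trans ?_
    rw [h3, ← pow_add, ← pow_mul, ← pow_add]
    exact Nat.pow_le_pow_right (by norm_num) (by omega)
  exact (Nat.pow_le_pow_iff_left (by norm_num)).1 (Nat.le_of_mul_le_mul_right h4 (by positivity))

/-- With `q = 2 ^ L > n` the loss `(1 + 1/q) ^ n` is at most `e < 4`. -/
theorem card_ball_le_of_lt_two_pow {n t L : ℕ} (h : n < 2 ^ L) :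
    (ball n t).card ≤ 4 * 2 ^ (L * t) := by
  have h1 := card_ball_mul_pow_le n t (2 ^ L) (by positivity)
  have h2 : (2 ^ L + 1) ^ n ≤ 4 * (2 ^ L) ^ n := by
    have hq : (0 : ℝ) < 2 ^ L := by positivity
    have hn : (n : ℝ) ≤ 2 ^ L := by exact_mod_cast h.le
    have : ((2 : ℝ) ^ L + 1) ^ n ≤ 4 * (2 ^ L) ^ n := by
      have e : ((2 : ℝ) ^ L + 1) = 2 ^ L * (1 / 2 ^ L + 1) := by
        rw [mul_add, mul_one_div_cancel hq.ne', mul_one, add_comm]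
      rw [e, mul_pow, mul_comm 4]
      refine mul_le_mul_of_nonneg_left ?_ (by positivity)
      calc (1 / (2 : ℝ) ^ L + 1) ^ n ≤ (Real.exp (1 / 2 ^ L)) ^ n := by
            gcongr; exact Real.add_one_le_exp _
        _ = Real.exp (n * (1 / 2 ^ L)) := by rw [Real.exp_nat_mul]
        _ ≤ Real.exp 1 := by
            gcongr
            rw [mul_one_div, div_le_one hq]
            exact hn
        _ ≤ 4 := by linarith [Real.exp_one_lt_d9]
    exact_mod_cast this
  rw [pow_mul]
  refine Nat.le_of_mul_le_mul_right (c := (2 ^ L) ^ n) ?_ (by positivity)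
  calc (ball n t).card * (2 ^ L) ^ n ≤ _ := h1
    _ ≤ 4 * (2 ^ L) ^ n * (2 ^ L) ^ t := Nat.mul_le_mul_right _ h2
    _ = _ := by ring

/-- Multiplication by a word `z` loses only the coordinates where `z` vanishes. -/
theorem card_filter_mul_mem_le {n : ℕ} (z : Word n) (A : Finset (Word n)) :
    (Finset.univ.filter fun v : Word n => v * z ∈ A).card ≤ A.card * 2 ^ (n - hammingNorm z) := by
  have hc : Fintype.card ({i // z i = 0} → ZMod 2) = 2 ^ (n - hammingNorm z) := by
    rw [Fintype.card_fun, ZMod.card, Fintype.card_subtype, card_filter_eq_zero]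
  rw [← hc, ← Finset.card_univ, ← Finset.card_product]
  refine Finset.card_le_card_of_injOn (fun v => (v * z, fun i => v i)) ?_ ?_
  · intro v hv
    simpa using hv
  · intro v _ w _ h
    obtain ⟨h1, h2⟩ := Prod.mk.inj h
    funext i
    rcases zmod_two_eq (z i) with hz | hz
    · exact congrFun h2 ⟨i, hz⟩
    · simpa [hz] using congrFun h1 i

/-! ### Spans attached to a matrix -/

/-- The span of all the products of two rows; since `v * v = v` it contains the rows. -/
def prodSpan {j n : ℕ} (g : Matrix (Fin j) (Fin n) (ZMod 2)) : Submodule (ZMod 2) (Word n) :=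
  Submodule.span (ZMod 2) (Set.range fun p : Fin j × Fin j => (g p.1 * g p.2 : Word n))

/-- The span of all the products of two rows and of the all-ones word. -/
def prodSpanOne {j n : ℕ} (g : Matrix (Fin j) (Fin n) (ZMod 2)) : Submodule (ZMod 2) (Word n) :=
  prodSpan g ⊔ Submodule.span (ZMod 2) {1}

/-- The span of the rows and of the all-ones word. -/
def rowSpanOne {j n : ℕ} (g : Matrix (Fin j) (Fin n) (ZMod 2)) : Submodule (ZMod 2) (Word n) :=
  rowSpan g ⊔ Submodule.span (ZMod 2) {1}

theorem card_le_two_pow_of_span_range {n : ℕ} {ι : Type*} [Fintype ι] (f : ι → Word n)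
    (S : Submodule (ZMod 2) (Word n)) (h : S ≤ Submodule.span (ZMod 2) (Set.range f)) :
    (Set.toFinite (S : Set (Word n))).toFinset.card ≤ 2 ^ Fintype.card ι := by
  classical
  rw [← Set.ncard_eq_toFinset_card, ← Nat.card_coe_set_eq]
  have h1 := Module.natCard_eq_pow_finrank (K := ZMod 2) (V := S)
  simp only [SetLike.coe_sort_coe]
  rw [h1, Nat.card_zmod]
  exact Nat.pow_le_pow_right (by norm_num)
    ((Submodule.finrank_mono h).trans (finrank_range_le_card f))

theorem card_rowSpanOne_le {j n : ℕ} (g : Matrix (Fin j) (Fin n) (ZMod 2)) :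
    (Set.toFinite (rowSpanOne g : Set (Word n))).toFinset.card ≤ 2 ^ (j + 1) := by
  have h := card_le_two_pow_of_span_range (ι := Fin j ⊕ Unit) (Sum.elim (fun a => g a) fun _ => 1)
    (rowSpanOne g) (by
      rw [Set.Sum.elim_range, Submodule.span_union, Set.range_const, rowSpanOne, rowSpan])
  simpa using h

theorem card_prodSpanOne_le {j n : ℕ} (g : Matrix (Fin j) (Fin n) (ZMod 2)) :
    (Set.toFinite (prodSpanOne g : Set (Word n))).toFinset.card ≤ 2 ^ (j * j + 1) := by
  have h := card_le_two_pow_of_span_range (ι := Fin j × Fin j ⊕ Unit)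
    (Sum.elim (fun p => g p.1 * g p.2) fun _ => 1) (prodSpanOne g) (by
      rw [Set.Sum.elim_range, Submodule.span_union, Set.range_const, prodSpanOne, prodSpan])
  simpa using h

theorem mem_rowSpanOne_appendRow {j n : ℕ} {g : Matrix (Fin j) (Fin n) (ZMod 2)} {v z : Word n}
    (h : z ∈ rowSpanOne (appendRow g v)) : z ∈ rowSpanOne g ∨ v + z ∈ rowSpanOne g := by
  have hle : rowSpanOne (appendRow g v) ≤ rowSpanOne g ⊔ Submodule.span (ZMod 2) {v} := by
    refine sup_le (Submodule.span_le.2 ?_) (le_sup_right.trans le_sup_left)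
    rintro _ ⟨a, rfl⟩
    refine Fin.lastCases ?_ (fun a => ?_) a
    · simp only [appendRow_last]
      exact Submodule.mem_sup_right (Submodule.mem_span_singleton_self v)
    · simp only [appendRow_castSucc]
      exact Submodule.mem_sup_left (Submodule.mem_sup_left (Submodule.subset_span ⟨a, rfl⟩))
  obtain ⟨y, hy, w, hw, rfl⟩ := Submodule.mem_sup.1 (hle h)
  obtain ⟨c, rfl⟩ := Submodule.mem_span_singleton.1 hw
  rcases zmod_two_eq c with rfl | rfl
  · left; simpa using hy
  · right
    rwa [one_smul, add_left_comm, word_add_self, add_zero]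

/-- The new products are `v * g a` and `v * v = v * 1`. The last one is why the all-ones word is
adjoined to the row span. -/
theorem prodSpan_appendRow_le {j n : ℕ} (g : Matrix (Fin j) (Fin n) (ZMod 2)) (v : Word n) :
    prodSpan (appendRow g v) ≤
      prodSpan g ⊔ (rowSpanOne g).map (LinearMap.mulLeft (ZMod 2) v) := by
  refine Submodule.span_le.2 ?_
  have hr (a : Fin j) : v * g a ∈ (rowSpanOne g).map (LinearMap.mulLeft (ZMod 2) v) :=
    ⟨g a, Submodule.mem_sup_left (Submodule.subset_span ⟨a, rfl⟩), rfl⟩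
  rintro _ ⟨⟨a, b⟩, rfl⟩
  refine Fin.lastCases ?_ (fun a => ?_) a <;> refine Fin.lastCases ?_ (fun b => ?_) b <;>
    simp only [appendRow_last, appendRow_castSucc]
  · exact Submodule.mem_sup_right
      ⟨1, Submodule.mem_sup_right (Submodule.mem_span_singleton_self 1), by
        simp [word_mul_self]⟩
  · exact Submodule.mem_sup_right (hr b)
  · rw [mul_comm]
    exact Submodule.mem_sup_right (hr a)
  · exact Submodule.mem_sup_left (Submodule.subset_span ⟨(a, b), rfl⟩)

theorem exists_of_mem_prodSpan_appendRow {j n : ℕ} {g : Matrix (Fin j) (Fin n) (ZMod 2)}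
    {v u : Word n} (h : u ∈ prodSpan (appendRow g v)) :
    ∃ z ∈ rowSpanOne g, v * z + u ∈ prodSpan g := by
  obtain ⟨y, hy, _, ⟨z, hz, rfl⟩, rfl⟩ := Submodule.mem_sup.1 (prodSpan_appendRow_le g v h)
  refine ⟨z, hz, ?_⟩
  rwa [LinearMap.mulLeft_apply, add_left_comm, word_add_self, add_zero]

theorem exists_of_mem_prodSpanOne_appendRow {j n : ℕ} {g : Matrix (Fin j) (Fin n) (ZMod 2)}
    {v u : Word n} (h : u ∈ prodSpanOne (appendRow g v)) :
    ∃ z ∈ rowSpanOne g, v * z + u ∈ prodSpanOne g := by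
  obtain ⟨y, hy, w, hw, rfl⟩ := Submodule.mem_sup.1 h
  obtain ⟨z, hz, hzy⟩ := exists_of_mem_prodSpan_appendRow hy
  refine ⟨z, hz, ?_⟩
  rw [← add_assoc]
  exact add_mem (Submodule.mem_sup_left hzy) (Submodule.mem_sup_right hw)

theorem prodSpanOne_le_appendRow {j n : ℕ} (g : Matrix (Fin j) (Fin n) (ZMod 2)) (v : Word n) :
    prodSpanOne g ≤ prodSpanOne (appendRow g v) := by
  refine sup_le_sup_right (Submodule.span_le.2 ?_) _
  rintro _ ⟨⟨a, b⟩, rfl⟩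
  exact Submodule.subset_span ⟨(a.castSucc, b.castSucc), by simp [appendRow_castSucc]⟩

/-! ### Admissible rows -/

/-- A word outside a code is detected by a word of the dual code. -/
theorem exists_mem_dualCode_dotProduct_eq_one {n : ℕ} {C : Submodule (ZMod 2) (Word n)}
    {u : Word n} (hu : u ∉ C) : ∃ w ∈ dualCode C, w ⬝ᵥ u = 1 := by
  obtain ⟨f, hf, hC⟩ := Submodule.exists_le_ker_of_notMem hu
  have hdot (x : Word n) : (fun i => f (Pi.single i 1)) ⬝ᵥ x = f x := by
    conv_rhs => rw [pi_eq_sum_univ' x]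
    simp only [map_sum, map_smul, dotProduct, smul_eq_mul, mul_comm]
  refine ⟨fun i => f (Pi.single i 1), fun x hx => ?_, ?_⟩
  · rw [hdot]
    exact hC hx
  · rw [hdot]
    exact (zmod_two_eq _).resolve_left hf

theorem mem_dualCode_span {n : ℕ} {s : Set (Word n)} {v : Word n} :
    v ∈ dualCode (Submodule.span (ZMod 2) s) ↔ ∀ u ∈ s, v ⬝ᵥ u = 0 := by
  refine ⟨fun h u hu => h u (Submodule.subset_span hu), fun h u hu => ?_⟩
  induction hu using Submodule.span_induction with
  | mem x hx => exact h x hx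
  | zero => exact dotProduct_zero v
  | add x y _ _ hx hy => rw [dotProduct_add, hx, hy, add_zero]
  | smul c x _ hx => rw [dotProduct_smul, hx, smul_zero]

theorem mem_dualCode_prodSpanOne {j n : ℕ} {g : Matrix (Fin j) (Fin n) (ZMod 2)} {v : Word n} :
    v ∈ dualCode (prodSpanOne g) ↔ v ∈ dualCode (prodSpan g) ∧ ∑ i, v i = 0 := by
  rw [prodSpanOne, prodSpan, ← Submodule.span_union, mem_dualCode_span, mem_dualCode_span]
  constructor
  · intro h
    exact ⟨fun u hu => h u (Or.inl hu), by rw [← dotProduct_one]; exact h 1 (Or.inr rfl)⟩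
  · rintro ⟨h1, h2⟩ u (hu | rfl)
    · exact h1 u hu
    · rw [dotProduct_one, h2]

/-- Idempotence `c * c = c` makes the pair conditions the diagonal case of the triple conditions, so
both become orthogonality to a single span. -/
theorem mem_admissibleRows_iff {j n kT : ℕ} {g : Matrix (Fin j) (Fin n) (ZMod 2)} {v : Word n} :
    v ∈ admissibleRows kT g ↔
      v ∈ dualCode (prodSpan g) ∧ ∑ i, v i = if j < kT then 1 else 0 := by
  have key : v ∈ dualCode (prodSpan g) ↔ (∀ a, ∑ i, g a i * v i = 0) ∧
      ∀ a b, a < b → ∑ i, g a i * g b i * v i = 0 := by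
    rw [prodSpan, mem_dualCode_span]
    constructor
    · intro h
      have h' (a b : Fin j) : ∑ i, g a i * g b i * v i = 0 := by
        have := h _ ⟨(a, b), rfl⟩
        rw [dotProduct_comm] at this
        exact this
      refine ⟨fun a => ?_, fun a b _ => h' a b⟩
      rw [← h' a a]
      exact Finset.sum_congr rfl fun i _ => by rw [zmod_two_mul_self]
    · rintro ⟨h1, h2⟩ _ ⟨⟨a, b⟩, rfl⟩
      rw [dotProduct_comm]
      change ∑ i, g a i * g b i * v i = 0
      rcases lt_trichotomy a b with h | rfl | h
      · exact h2 a b h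
      · rw [← h1 a]
        exact Finset.sum_congr rfl fun i _ => by rw [zmod_two_mul_self]
      · rw [← h2 b a h]
        exact Finset.sum_congr rfl fun i _ => by rw [mul_comm (g a i)]
  rw [key, and_assoc]
  simp [admissibleRows]

theorem add_mem_admissibleRows {j n kT : ℕ} {g : Matrix (Fin j) (Fin n) (ZMod 2)} {v w : Word n}
    (hv : v ∈ admissibleRows kT g) (hw : w ∈ dualCode (prodSpanOne g)) :
    v + w ∈ admissibleRows kT g := by
  rw [mem_admissibleRows_iff] at hv ⊢
  rw [mem_dualCode_prodSpanOne] at hw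
  refine ⟨add_mem hv.1 hw.1, ?_⟩
  simp only [Pi.add_apply, Finset.sum_add_distrib, hv.2, hw.2, add_zero]

/-- An odd word orthogonal to `prodSpan g` exists once `1` lies outside that span; for an even row
the zero word is always available. -/
theorem admissibleRows_nonempty {j n kT : ℕ} {g : Matrix (Fin j) (Fin n) (ZMod 2)}
    (h : (1 : Word n) ∉ prodSpan g) : (admissibleRows kT g).Nonempty := by
  by_cases hj : j < kT
  · obtain ⟨w, hw, hw1⟩ := exists_mem_dualCode_dotProduct_eq_one h
    exact ⟨w, mem_admissibleRows_iff.2 ⟨hw, by rw [if_pos hj, ← dotProduct_one, hw1]⟩⟩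
  · exact ⟨0, mem_admissibleRows_iff.2 ⟨zero_mem _, by simp [hj]⟩⟩

theorem two_pow_le_card_dualCode_span {n : ℕ} {ι : Type*} [Fintype ι] (f : ι → Word n) :
    2 ^ n ≤ Nat.card (dualCode (Submodule.span (ZMod 2) (Set.range f))) * 2 ^ Fintype.card ι := by
  let φ : Word n →ₗ[ZMod 2] (ι → ZMod 2) := (Matrix.of f).mulVecLin
  have hker : LinearMap.ker φ = dualCode (Submodule.span (ZMod 2) (Set.range f)) := by
    ext v
    rw [mem_dualCode_span, LinearMap.mem_ker, funext_iff, Set.forall_mem_range]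
    exact forall_congr' fun i => by rw [dotProduct_comm]; rfl
  rw [← hker, Module.natCard_eq_pow_finrank (K := ZMod 2), Nat.card_zmod, ← pow_add]
  refine Nat.pow_le_pow_right (by norm_num) ?_
  have h1 := φ.finrank_range_add_finrank_ker
  have h2 := Submodule.finrank_le (LinearMap.range φ)
  rw [Module.finrank_fintype_fun_eq_card] at h1 h2
  rw [Fintype.card_fin] at h1
  omega

/-- The admissible rows contain a translate of `dualCode (prodSpanOne g)`, which is cut out by `j *
j + 1` equations. -/
theorem two_pow_le_card_admissibleRows {j n kT : ℕ} {g : Matrix (Fin j) (Fin n) (ZMod 2)}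
    (h : (admissibleRows kT g).Nonempty) :
    2 ^ n ≤ (admissibleRows kT g).card * 2 ^ (j * j + 1) := by
  obtain ⟨v, hv⟩ := h
  have h1 := two_pow_le_card_dualCode_span (ι := Fin j × Fin j ⊕ Unit)
    (Sum.elim (fun p => (g p.1 * g p.2 : Word n)) fun _ => 1)
  rw [Set.Sum.elim_range, Submodule.span_union, Set.range_const] at h1
  change 2 ^ n ≤ Nat.card (dualCode (prodSpanOne g)) * _ at h1
  have h2 : Nat.card (dualCode (prodSpanOne g)) ≤ (admissibleRows kT g).card := by
    rw [← Fintype.card_coe, ← Nat.card_eq_fintype_card]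
    refine Nat.card_le_card_of_injective
      (fun w => (⟨v + w, add_mem_admissibleRows hv w.2⟩ : admissibleRows kT g)) ?_
    intro w w' h
    exact Subtype.ext (add_left_cancel (Subtype.mk.inj h))
  simp only [Fintype.card_sum, Fintype.card_prod, Fintype.card_fin, Fintype.card_unit] at h1
  exact h1.trans (Nat.mul_le_mul_right _ h2)

/-- A word outside `prodSpanOne g` is orthogonal to at most half of the admissible rows. -/
theorem two_mul_card_filter_admissibleRows_le {j n kT : ℕ} {g : Matrix (Fin j) (Fin n) (ZMod 2)}
    {u : Word n} (hu : u ∉ prodSpanOne g) :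
    2 * ((admissibleRows kT g).filter fun v => v ⬝ᵥ u = 0).card ≤ (admissibleRows kT g).card := by
  obtain ⟨w, hw, hw1⟩ := exists_mem_dualCode_dotProduct_eq_one hu
  have h1 : ((admissibleRows kT g).filter fun v => v ⬝ᵥ u = 0).card +
      ((admissibleRows kT g).filter fun v => ¬ v ⬝ᵥ u = 0).card = (admissibleRows kT g).card :=
    Finset.card_filter_add_card_filter_not _
  have h2 : ((admissibleRows kT g).filter fun v => v ⬝ᵥ u = 0).card ≤
      ((admissibleRows kT g).filter fun v => ¬ v ⬝ᵥ u = 0).card := by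
    -- Translation by `w` preserves admissibility and flips the product with `u`.
    refine Finset.card_le_card_of_injOn (fun v => v + w) ?_ (add_left_injective w).injOn
    intro v hv
    simp only [Finset.coe_filter, Set.mem_ofPred_eq] at hv ⊢
    exact ⟨add_mem_admissibleRows hv.1 hw, by rw [add_dotProduct, hv.2, hw1]; decide⟩
  omega

/-! ### Generic matrices -/

/-- Triorthogonal matrices without light words in the spans that govern the next choice of row. -/
structure IsGeneric {j n : ℕ} (kT t d : ℕ) (g : Matrix (Fin j) (Fin n) (ZMod 2)) : Prop where
  triorthogonal : IsTriorthogonal kT g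
  row_weight : ∀ z ∈ rowSpanOne g, z ≠ 0 → t < hammingNorm z
  prod_weight : ∀ u ∈ prodSpanOne g, u ≠ 0 → d < hammingNorm u
  one_notMem : (1 : Word n) ∉ prodSpan g

open Classical in
/-- The choices of the next row that may spoil genericity. -/
noncomputable def badRows {j n : ℕ} (t d : ℕ) (g : Matrix (Fin j) (Fin n) (ZMod 2)) :
    Finset (Word n) :=
  {v | (∃ z ∈ rowSpanOne g, hammingNorm (v + z) ≤ t) ∨
    ∃ z ∈ rowSpanOne g, z ≠ 0 ∧ ∃ u : Word n, hammingNorm u ≤ d ∧ v * z + u ∈ prodSpanOne g}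

theorem IsTriorthogonal.appendRow {j n kT : ℕ} {g : Matrix (Fin j) (Fin n) (ZMod 2)}
    (hg : IsTriorthogonal kT g) {v : Word n} (hv : v ∈ admissibleRows kT g) :
    IsTriorthogonal kT (appendRow g v) := by
  simp only [admissibleRows, Finset.mem_filter, Finset.mem_univ, true_and] at hv
  obtain ⟨h1, h2, h3⟩ := hv
  refine ⟨fun a b => ?_, fun a b c => ?_, fun a => ?_, fun a => ?_⟩
  · induction b using Fin.lastCases with
    | last =>
      induction a using Fin.lastCases with
      | last => exact fun h => absurd h (lt_irrefl _)
      | cast a => intro _; simpa only [appendRow_last, appendRow_castSucc] using h1 a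
    | cast b =>
      induction a using Fin.lastCases with
      | last => exact fun h => absurd h (Fin.castSucc_lt_last b).not_gt
      | cast a =>
        intro h
        simpa only [appendRow_castSucc] using hg.pairs a b (Fin.castSucc_lt_castSucc_iff.1 h)
  · intro hab hbc
    induction b using Fin.lastCases with
    | last => exact absurd hbc (Fin.le_last c).not_gt
    | cast b =>
      induction a using Fin.lastCases with
      | last => exact absurd hab (Fin.castSucc_lt_last b).not_gt
      | cast a =>
        have hab' := Fin.castSucc_lt_castSucc_iff.1 hab
        induction c using Fin.lastCases with
        | last => simpa only [appendRow_last, appendRow_castSucc] using h2 a b hab'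
        | cast c =>
          simpa only [appendRow_castSucc] using
            hg.triples a b c hab' (Fin.castSucc_lt_castSucc_iff.1 hbc)
  · induction a using Fin.lastCases with
    | last =>
      intro h; rw [Fin.val_last] at h; rw [if_pos h] at h3
      simpa only [appendRow_last] using h3
    | cast a => intro h; simpa only [appendRow_castSucc] using hg.odd a h
  · induction a using Fin.lastCases with
    | last =>
      intro h; rw [Fin.val_last] at h; rw [if_neg h.not_gt] at h3
      simpa only [appendRow_last] using h3
    | cast a => intro h; simpa only [appendRow_castSucc] using hg.even a h

theorem IsGeneric.appendRow {j n kT t d : ℕ} {g : Matrix (Fin j) (Fin n) (ZMod 2)}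
    (hg : IsGeneric kT t d g) {v : Word n} (hv : v ∈ admissibleRows kT g)
    (hbad : v ∉ badRows t d g) : IsGeneric kT t d (appendRow g v) := by
  simp only [badRows, Finset.mem_filter, Finset.mem_univ, true_and, not_or, not_exists, not_and,
    not_le] at hbad
  obtain ⟨h1, h2⟩ := hbad
  refine ⟨hg.triorthogonal.appendRow hv, fun z hz hz0 => ?_, fun u hu hu0 => ?_, fun h => ?_⟩
  · rcases mem_rowSpanOne_appendRow hz with h | h
    · exact hg.row_weight z h hz0
    · have := h1 _ h
      rwa [← add_assoc, word_add_self, zero_add] at this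
  · obtain ⟨z, hz, hzu⟩ := exists_of_mem_prodSpanOne_appendRow hu
    by_cases hz0 : z = 0
    · refine hg.prod_weight u ?_ hu0
      simpa [hz0] using hzu
    · by_contra hlt
      exact h2 z hz hz0 u (not_lt.1 hlt) hzu
  · obtain ⟨z, hz, hzu⟩ := exists_of_mem_prodSpan_appendRow h
    by_cases hz0 : z = 0
    · refine hg.one_notMem ?_
      simpa [hz0] using hzu
    -- If `v * z + 1` lies in `prodSpan g`, then `v * z` lies in `prodSpanOne g`, so the case `u =
    -- 0` of the second bad event applies.
    · refine h2 z hz hz0 0 (by simp) ?_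
      have h1 : (1 : Word n) ∈ prodSpanOne g :=
        Submodule.mem_sup_right (Submodule.mem_span_singleton_self 1)
      have := add_mem (Submodule.mem_sup_left hzu : _ ∈ prodSpanOne g) h1
      rwa [add_assoc, word_add_self] at this

theorem isGeneric_of_isEmpty {n kT t d : ℕ} (ht : t < n) (hd : d < n)
    (g : Matrix (Fin 0) (Fin n) (ZMod 2)) : IsGeneric kT t d g := by
  have hone : ∀ z ∈ Submodule.span (ZMod 2) {(1 : Word n)}, z ≠ 0 → hammingNorm z = n := by
    intro z hz hz0
    obtain ⟨c, rfl⟩ := Submodule.mem_span_singleton.1 hz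
    rcases zmod_two_eq c with rfl | rfl
    · simp at hz0
    · simp [hammingNorm]
  have hp : prodSpan g = ⊥ := by rw [prodSpan, Set.range_eq_empty, Submodule.span_empty]
  have hr : rowSpan g = ⊥ := by rw [rowSpan, Set.range_eq_empty, Submodule.span_empty]
  refine ⟨⟨fun a => a.elim0, fun a => a.elim0, fun a => a.elim0, fun a => a.elim0⟩,
    fun z hz hz0 => ?_, fun z hz hz0 => ?_, ?_⟩
  · rw [rowSpanOne, hr, bot_sup_eq] at hz
    rwa [hone z hz hz0]
  · rw [prodSpanOne, hp, bot_sup_eq] at hz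
    rwa [hone z hz hz0]
  · rw [hp, Submodule.mem_bot]
    intro h
    exact one_ne_zero (congrFun h ⟨0, by omega⟩)

/-- The first term counts translates of a ball by `rowSpanOne g`. In the second, for fixed `z` and
`u`, the product `v * z` lies in a translate of `prodSpanOne g`, and each of its values comes from
at most `2 ^ (n - t)` words because `z` is heavy. -/
theorem IsGeneric.card_badRows_le {j n kT t d : ℕ} {g : Matrix (Fin j) (Fin n) (ZMod 2)}
    (hg : IsGeneric kT t d g) :
    (badRows t d g).card ≤ 2 ^ (j + 1) * (ball n t).card +
      2 ^ (j + 1) * (ball n d).card * (2 ^ (j * j + 1) * 2 ^ (n - t)) := by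
  classical
  set Z := (Set.toFinite (rowSpanOne g : Set (Word n))).toFinset with hZ
  set D := (Set.toFinite (prodSpanOne g : Set (Word n))).toFinset with hD
  have hsub : badRows t d g ⊆ (Z.biUnion fun z => (ball n t).image (· + z)) ∪
      (Z.filter (· ≠ 0) ×ˢ ball n d).biUnion fun p =>
        Finset.univ.filter fun v : Word n => v * p.1 ∈ D.image (· + p.2) := by
    intro v hv
    simp only [badRows, Finset.mem_filter, Finset.mem_univ, true_and] at hv
    rw [Finset.mem_union]
    rcases hv with ⟨z, hz, h⟩ | ⟨z, hz, hz0, u, hu, h⟩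
    · left
      refine Finset.mem_biUnion.2 ⟨z, by simpa [hZ] using hz, ?_⟩
      refine Finset.mem_image.2 ⟨v + z, mem_ball.2 h, ?_⟩
      rw [add_assoc, word_add_self, add_zero]
    · right
      refine Finset.mem_biUnion.2 ⟨(z, u), ?_, ?_⟩
      · simp only [Finset.mem_product, Finset.mem_filter]
        exact ⟨⟨by simpa [hZ] using hz, hz0⟩, mem_ball.2 hu⟩
      · simp only [Finset.mem_filter, Finset.mem_univ, true_and]
        refine Finset.mem_image.2 ⟨v * z + u, by simpa [hD] using h, ?_⟩
        rw [add_assoc, word_add_self, add_zero]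
  refine (Finset.card_le_card hsub).trans ((Finset.card_union_le _ _).trans (add_le_add ?_ ?_))
  · refine (Finset.card_biUnion_le_card_mul _ _ _ fun z _ => Finset.card_image_le).trans ?_
    exact Nat.mul_le_mul_right _ (card_rowSpanOne_le g)
  · refine (Finset.card_biUnion_le_card_mul _ _ (2 ^ (j * j + 1) * 2 ^ (n - t)) ?_).trans ?_
    · rintro ⟨z, u⟩ hp
      simp only [Finset.mem_product, Finset.mem_filter] at hp
      refine (card_filter_mul_mem_le z _).trans ?_
      have hz := hg.row_weight z (by simpa [hZ] using hp.1.1) hp.1.2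
      exact Nat.mul_le_mul (Finset.card_image_le.trans (card_prodSpanOne_le g))
        (Nat.pow_le_pow_right (by norm_num) (by omega))
    · rw [Finset.card_product]
      exact Nat.mul_le_mul_right _ (Nat.mul_le_mul_right _
        ((Finset.card_filter_le _ _).trans (card_rowSpanOne_le g)))

/-! ### The law of the algorithm -/

theorem toOuterMeasure_le_one {α : Type*} (p : PMF α) (S : Set α) : p.toOuterMeasure S ≤ 1 := by
  rw [PMF.toOuterMeasure_apply, ← p.tsum_coe]
  exact ENNReal.tsum_le_tsum fun a => Set.indicator_le_self _ _ a

theorem toOuterMeasure_bind_le_add {α β : Type*} (p : PMF α) (f : α → PMF β) (B : Set α)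
    (T : Set β) (δ : ℝ≥0∞) (h : ∀ a ∉ B, (f a).toOuterMeasure T ≤ δ) :
    (p.bind f).toOuterMeasure T ≤ p.toOuterMeasure B + δ := by
  classical
  rw [PMF.toOuterMeasure_bind_apply, PMF.toOuterMeasure_apply]
  calc ∑' a, p a * (f a).toOuterMeasure T ≤ ∑' a, (B.indicator p a + p a * δ) := by
        refine ENNReal.tsum_le_tsum fun a => ?_
        by_cases ha : a ∈ B
        · rw [Set.indicator_of_mem ha]
          exact (mul_le_of_le_one_right' (toOuterMeasure_le_one _ _)).trans le_self_add
        · exact (mul_le_mul_right (h a ha) _).trans le_add_self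
    _ = _ := by rw [ENNReal.tsum_add, ENNReal.tsum_mul_right, p.tsum_coe, one_mul]

/-- `T` is reachable only through `B`, so iterating over the steps multiplies conditional
probabilities. -/
theorem toOuterMeasure_bind_le_mul {α β : Type*} (p : PMF α) (f : α → PMF β) (B : Set α)
    (T : Set β) (δ : ℝ≥0∞) (h : ∀ a ∈ B, (f a).toOuterMeasure T ≤ δ)
    (h' : ∀ a ∉ B, (f a).toOuterMeasure T = 0) :
    (p.bind f).toOuterMeasure T ≤ p.toOuterMeasure B * δ := by
  classical
  rw [PMF.toOuterMeasure_bind_apply, PMF.toOuterMeasure_apply, ← ENNReal.tsum_mul_right]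
  refine ENNReal.tsum_le_tsum fun a => ?_
  by_cases ha : a ∈ B
  · rw [Set.indicator_of_mem ha]
    gcongr
    exact h a ha
  · simp [h' a ha]

theorem toOuterMeasure_step_some {j n kT : ℕ} {g : Matrix (Fin j) (Fin n) (ZMod 2)}
    (h : (admissibleRows kT g).Nonempty) (S : Set (Option (Matrix (Fin (j + 1)) (Fin n) (ZMod 2))))
    [DecidablePred fun v => some (appendRow g v) ∈ S] :
    (step kT (some g)).toOuterMeasure S =
      (((admissibleRows kT g).filter fun v => some (appendRow g v) ∈ S).card : ℝ≥0∞) /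
        (admissibleRows kT g).card := by
  rw [step, nextRow, dif_pos h, PMF.toOuterMeasure_map_apply, PMF.toOuterMeasure_map_apply,
    PMF.toOuterMeasure_uniformOfFinset_apply]
  congr!

theorem mem_support_step {j n kT : ℕ} {o : Option (Matrix (Fin j) (Fin n) (ZMod 2))}
    {G : Matrix (Fin (j + 1)) (Fin n) (ZMod 2)} (h : some G ∈ (step kT o).support) :
    ∃ g v, o = some g ∧ G = appendRow g v := by
  rcases o with _ | g
  · simp [step] at h
  · rw [step, PMF.mem_support_map_iff] at h
    obtain ⟨_ | v, _, h⟩ := h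
    · simp at h
    · exact ⟨g, v, rfl, (Option.some.inj h).symm⟩

/-- From a generic matrix the algorithm cannot fail at the next step, and it leaves genericity only
through `badRows`; the losses add up over the steps. -/
theorem toOuterMeasure_algorithm_not_isGeneric_le {n kT t d : ℕ} (ht : t < n) (hd : d < n) (m : ℕ)
    (δ : ℝ≥0∞) (hδ : ∀ j < m, ∀ g : Matrix (Fin j) (Fin n) (ZMod 2), IsGeneric kT t d g →
      ((badRows t d g).card : ℝ≥0∞) ≤ δ * (admissibleRows kT g).card) :
    (algorithm n kT m).toOuterMeasure (some '' {g | IsGeneric kT t d g})ᶜ ≤ m * δ := by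
  classical
  induction m with
  | zero =>
    rw [algorithm, PMF.toOuterMeasure_pure_apply, if_neg]
    · exact zero_le
    · exact fun h => h ⟨_, isGeneric_of_isEmpty ht hd _, rfl⟩
  | succ m ih =>
    rw [algorithm, Nat.cast_succ, add_mul, one_mul]
    refine (toOuterMeasure_bind_le_add _ _ (some '' {g | IsGeneric kT t d g})ᶜ _ δ ?_).trans
      (add_le_add_left (ih fun j hj => hδ j (hj.trans m.lt_succ_self)) δ)
    rintro _ ho
    obtain ⟨g, hg, rfl⟩ := not_not.1 ho
    have hne := admissibleRows_nonempty (kT := kT) hg.one_notMem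
    rw [toOuterMeasure_step_some hne]
    refine ENNReal.div_le_of_le_mul (le_trans ?_ (hδ m m.lt_succ_self g hg))
    norm_cast
    refine Finset.card_le_card fun v hv => ?_
    rw [Finset.mem_filter] at hv
    by_contra hb
    exact hv.2 ⟨_, hg.appendRow hv.1 hb, rfl⟩

/-- The matrices without light words in `prodSpanOne` all of whose even rows are orthogonal
to `u`. -/
def orthogonalMatrices {j n : ℕ} (kT d : ℕ) (u : Word n) :
    Set (Matrix (Fin j) (Fin n) (ZMod 2)) :=
  {g | (∀ w ∈ prodSpanOne g, w ≠ 0 → d < hammingNorm w) ∧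
    ∀ a : Fin j, kT ≤ (a : ℕ) → g a ⬝ᵥ u = 0}

/-- Including the absence of light words in the event keeps `u` outside `prodSpanOne` at every step,
so each even row costs a factor `1/2`. -/
theorem toOuterMeasure_algorithm_orthogonalMatrices_le {n kT d : ℕ} {u : Word n} (hu0 : u ≠ 0)
    (hu : hammingNorm u ≤ d) (k : ℕ) :
    (algorithm n kT (kT + k)).toOuterMeasure (some '' orthogonalMatrices kT d u) ≤
      (2⁻¹ : ℝ≥0∞) ^ k := by
  classical
  induction k with
  | zero => exact (toOuterMeasure_le_one _ _).trans_eq (pow_zero _).symm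
  | succ k ih =>
    rw [← add_assoc, algorithm, pow_succ]
    refine (toOuterMeasure_bind_le_mul _ _ (some '' orthogonalMatrices kT d u) _ 2⁻¹ ?_ ?_).trans
      (mul_le_mul_left ih _)
    · rintro _ ⟨g, ⟨hg, _⟩, rfl⟩
      have huD : u ∉ prodSpanOne g := fun h => absurd (hg u h hu0) hu.not_gt
      have hne : (admissibleRows kT g).Nonempty :=
        ⟨0, mem_admissibleRows_iff.2 ⟨zero_mem _, by simp⟩⟩
      rw [toOuterMeasure_step_some hne]
      refine ENNReal.div_le_of_le_mul ?_
      rw [← ENNReal.mul_le_mul_iff_right (a := 2) (by simp) (by simp), ← mul_assoc,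
        ENNReal.mul_inv_cancel (by simp) (by simp), one_mul]
      refine le_trans ?_ (Nat.cast_le.2 (two_mul_card_filter_admissibleRows_le (kT := kT) huD))
      norm_cast
      refine Nat.mul_le_mul_left _ (Finset.card_le_card fun v hv => ?_)
      rw [Finset.mem_filter] at hv ⊢
      refine ⟨hv.1, ?_⟩
      obtain ⟨G, hG, hGv⟩ := hv.2
      have h := hG.2 (Fin.last _) (by simp)
      rwa [Option.some.inj hGv, appendRow_last] at h
    · intro o ho
      rw [PMF.toOuterMeasure_apply_eq_zero_iff, Set.disjoint_right]
      rintro _ ⟨G, hG, rfl⟩ hs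
      obtain ⟨g, v, rfl, rfl⟩ := mem_support_step hs
      -- The event passes to the matrix without its last row, since `prodSpanOne` only grows.
      refine ho ⟨g, ⟨fun w hw => hG.1 w (prodSpanOne_le_appendRow g v hw), fun a ha => ?_⟩, rfl⟩
      have h := hG.2 a.castSucc (by simpa using ha)
      rwa [appendRow_castSucc] at h

/-- The generic matrices whose even rows detect all the light words. -/
def goodMatrices {m n : ℕ} (kT t d : ℕ) : Set (Matrix (Fin m) (Fin n) (ZMod 2)) :=
  {G | IsGeneric kT t d G ∧ ∀ u : Word n, u ≠ 0 → hammingNorm u ≤ d →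
    ∃ a : Fin m, kT ≤ (a : ℕ) ∧ G a ⬝ᵥ u ≠ 0}

theorem toOuterMeasure_algorithm_goodMatrices_compl_le {n kT t d k : ℕ} (ht : t < n) (hd : d < n)
    (δ : ℝ≥0∞) (hδ : ∀ j < kT + k, ∀ g : Matrix (Fin j) (Fin n) (ZMod 2), IsGeneric kT t d g →
      ((badRows t d g).card : ℝ≥0∞) ≤ δ * (admissibleRows kT g).card) :
    (algorithm n kT (kT + k)).toOuterMeasure (some '' goodMatrices kT t d)ᶜ ≤
      (kT + k : ℕ) * δ + (ball n d).card * 2⁻¹ ^ k := by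
  have hsub : (some '' goodMatrices kT t d)ᶜ ⊆
      (some '' {g : Matrix (Fin (kT + k)) (Fin n) (ZMod 2) | IsGeneric kT t d g})ᶜ ∪
        ⋃ u ∈ (ball n d).filter (· ≠ 0), some '' orthogonalMatrices kT d u := by
    intro o ho
    by_cases hg : o ∈ (some '' {g : Matrix (Fin (kT + k)) (Fin n) (ZMod 2) | IsGeneric kT t d g})
    · right
      obtain ⟨g, hg, rfl⟩ := hg
      by_contra hu
      refine ho ⟨g, ⟨hg, fun u hu0 hud => ?_⟩, rfl⟩
      by_contra! h
      refine hu (Set.mem_biUnion (x := u) ?_ ⟨g, ⟨hg.prod_weight, h⟩, rfl⟩)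
      simpa [mem_ball] using ⟨hud, hu0⟩
    · exact Or.inl hg
  refine (MeasureTheory.measure_mono hsub).trans ((MeasureTheory.measure_union_le _ _).trans
    (add_le_add (toOuterMeasure_algorithm_not_isGeneric_le ht hd _ δ hδ) ?_))
  refine (MeasureTheory.measure_biUnion_finset_le _ _).trans ?_
  refine (Finset.sum_le_card_nsmul _ _ (2⁻¹ ^ k) fun u hu => ?_).trans ?_
  · rw [Finset.mem_filter, mem_ball] at hu
    exact toOuterMeasure_algorithm_orthogonalMatrices_le hu.2 hu.1 k
  · rw [nsmul_eq_mul]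
    gcongr
    exact Finset.filter_subset _ _

/-! ### The distance of a triorthogonal matrix -/

theorem natCast_hammingNorm {n : ℕ} (v : Word n) : (hammingNorm v : ZMod 2) = ∑ i, v i := by
  rw [hammingNorm, Finset.card_filter, Nat.cast_sum]
  refine Finset.sum_congr rfl fun i _ => ?_
  rcases zmod_two_eq (v i) with h | h <;> simp [h]

theorem even_hammingNorm_iff {n : ℕ} (v : Word n) : Even (hammingNorm v) ↔ ∑ i, v i = 0 := by
  rw [← natCast_hammingNorm, ZMod.natCast_eq_zero_iff_even]

/-- The all-ones word witnesses that the distance is a minimum over a nonempty set. -/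
theorem one_mem_dualCode_evenRowSpan {m n : ℕ} (G : Matrix (Fin m) (Fin n) (ZMod 2)) :
    (1 : Word n) ∈ dualCode (evenRowSpan G) := by
  rw [evenRowSpan, mem_dualCode_span]
  rintro _ ⟨a, rfl, h⟩
  rw [one_dotProduct]
  exact (even_hammingNorm_iff _).1 h

theorem IsTriorthogonal.one_notMem_dualCode_rowSpan {m n kT : ℕ}
    {G : Matrix (Fin m) (Fin n) (ZMod 2)} (hG : IsTriorthogonal kT G) (hkT : 0 < kT) (hm : 0 < m) :
    (1 : Word n) ∉ dualCode (rowSpan G) := by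
  rw [rowSpan, mem_dualCode_span]
  intro h
  have h1 := h _ ⟨⟨0, hm⟩, rfl⟩
  rw [one_dotProduct, hG.odd _ hkT] at h1
  exact one_ne_zero h1

theorem IsTriorthogonal.exists_distance_eq {m n kT : ℕ}
    {G : Matrix (Fin m) (Fin n) (ZMod 2)} (hG : IsTriorthogonal kT G) (hkT : 0 < kT) (hm : 0 < m) :
    ∃ u : Word n, u ∈ dualCode (evenRowSpan G) ∧ u ∉ dualCode (rowSpan G) ∧
      hammingNorm u = distance G :=
  Nat.sInf_mem (s := {w | ∃ u : Word n, u ∈ dualCode (evenRowSpan G) ∧ u ∉ dualCode (rowSpan G) ∧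
    hammingNorm u = w}) ⟨_, 1, one_mem_dualCode_evenRowSpan G,
      hG.one_notMem_dualCode_rowSpan hkT hm, rfl⟩

/-- A word attaining the distance is nonzero and orthogonal to every even row, so goodness forbids
it to be light. -/
theorem lt_distance_of_mem_goodMatrices {m n kT t d : ℕ} {G : Matrix (Fin m) (Fin n) (ZMod 2)}
    (hG : G ∈ goodMatrices kT t d) (hkT : 0 < kT) (hm : 0 < m) : d < distance G := by
  obtain ⟨u, hu, hu', h⟩ := hG.1.triorthogonal.exists_distance_eq hkT hm
  rw [← h]
  by_contra hlt
  have hu0 : u ≠ 0 := by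
    rintro rfl
    exact hu' (zero_mem _)
  obtain ⟨a, ha, hau⟩ := hG.2 u hu0 (not_lt.1 hlt)
  rw [dotProduct_comm] at hau
  exact hau (hu _ (Submodule.subset_span
    ⟨a, rfl, (even_hammingNorm_iff _).2 (hG.1.triorthogonal.even a ha)⟩))

/-- A code spanned by fewer words than the size of the support of `u` has a nonzero dual word
on this support. -/
theorem exists_mem_dualCode_rowSpan_mul_eq {m n : ℕ} (G : Matrix (Fin m) (Fin n) (ZMod 2))
    {u : Word n} (hu : m < hammingNorm u) :
    ∃ v ∈ dualCode (rowSpan G), v ≠ 0 ∧ v * u = v := by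
  -- Orthogonality to the rows and vanishing off the support of `u` are `m + (n - hammingNorm u) <
  -- n` equations.
  let φ : Word n →ₗ[ZMod 2] (Fin m → ZMod 2) × ({i // u i = 0} → ZMod 2) :=
    (Matrix.mulVecLin G).prod (LinearMap.funLeft (ZMod 2) (ZMod 2) Subtype.val)
  have hker : LinearMap.ker φ ≠ ⊥ := by
    refine LinearMap.ker_ne_bot_of_finrank_lt ?_
    rw [Module.finrank_prod, Module.finrank_fintype_fun_eq_card,
      Module.finrank_fintype_fun_eq_card, Module.finrank_fintype_fun_eq_card, Fintype.card_fin,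
      Fintype.card_fin, Fintype.card_subtype, card_filter_eq_zero]
    have : hammingNorm u ≤ Fintype.card (Fin n) := hammingNorm_le_card_fintype
    rw [Fintype.card_fin] at this
    omega
  obtain ⟨v, hv, hv0⟩ := Submodule.exists_mem_ne_zero_of_ne_bot hker
  obtain ⟨h1, h2⟩ := Prod.mk.inj (LinearMap.mem_ker.1 hv)
  refine ⟨v, ?_, hv0, ?_⟩
  · rw [rowSpan, mem_dualCode_span]
    rintro _ ⟨a, rfl⟩
    rw [dotProduct_comm]
    exact congrFun h1 a
  · funext i
    rcases zmod_two_eq (u i) with h | h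
    · have : v i = 0 := congrFun h2 ⟨i, h⟩
      simp [this]
    · simp [h]

/-- A minimal word of weight above `m` could be shortened by adding a nonzero word of `dualCode
(rowSpan G)` inside its support, which affects neither membership condition. -/
theorem IsTriorthogonal.distance_le {m n kT : ℕ} {G : Matrix (Fin m) (Fin n) (ZMod 2)}
    (hG : IsTriorthogonal kT G) (hkT : 0 < kT) (hm : 0 < m) : distance G ≤ m := by
  obtain ⟨u, hu, hu', h⟩ := hG.exists_distance_eq hkT hm
  rw [← h]
  by_contra! hlt
  obtain ⟨v, hv, hv0, hvu⟩ := exists_mem_dualCode_rowSpan_mul_eq G hlt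
  have hle : evenRowSpan G ≤ rowSpan G :=
    Submodule.span_mono (by rintro _ ⟨a, rfl, _⟩; exact ⟨a, rfl⟩)
  have h1 : u + v ∈ dualCode (evenRowSpan G) := add_mem hu fun w hw => hv w (hle hw)
  have h2 : u + v ∉ dualCode (rowSpan G) := fun h => hu' ((add_mem_cancel_right hv).1 h)
  have h3 : distance G ≤ hammingNorm (u + v) := Nat.sInf_le ⟨u + v, h1, h2, rfl⟩
  have h4 : hammingNorm (u + v) < hammingNorm u := by
    obtain ⟨i, hi⟩ := Function.ne_iff.1 hv0
    have hvu' (i) : v i * u i = v i := congrFun hvu i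
    refine Finset.card_lt_card (Finset.ssubset_iff_of_subset ?_ |>.2 ⟨i, ?_, ?_⟩)
    · intro a ha
      simp only [Finset.mem_filter, Finset.mem_univ, true_and, Pi.add_apply] at ha ⊢
      intro h0
      have := hvu' a
      rw [h0, mul_zero] at this
      rw [h0, ← this, add_zero] at ha
      exact ha rfl
    · have := hvu' i
      simp only [Finset.mem_filter, Finset.mem_univ, true_and]
      intro h0
      rw [h0, mul_zero] at this
      exact hi this.symm
    · have := hvu' i
      have hvi := (zmod_two_eq (v i)).resolve_left hi
      rw [hvi, one_mul] at this
      simp only [Finset.mem_filter, Finset.mem_univ, true_and, Pi.add_apply, not_not]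
      rw [hvi, this]
      exact CharTwo.add_self_eq_zero 1
  omega

/-! ### The choice of parameters -/

/-- The number of odd rows, and of even rows. -/
def numRows (n : ℕ) : ℕ := Nat.sqrt n / 16

/-- The weight below which all words are detected. -/
def lightWeight (n : ℕ) : ℕ := numRows n / (2 * (Nat.log 2 n + 1))

theorem sq_numRows_le (n : ℕ) : 256 * (numRows n * numRows n) ≤ n := by
  have h1 : 16 * numRows n ≤ Nat.sqrt n := Nat.mul_div_le _ _
  have h2 := Nat.sqrt_le n
  nlinarith

theorem le_sq_numRows {n : ℕ} (h : 1 ≤ numRows n) : n ≤ 1024 * (numRows n * numRows n) := by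
  have h1 : Nat.sqrt n < 16 * (numRows n + 1) := by
    rw [numRows]; omega
  have h2 := Nat.lt_succ_sqrt n
  simp only [Nat.succ_eq_add_one] at h2
  nlinarith

theorem tendsto_numRows : Tendsto numRows atTop atTop := by
  refine tendsto_atTop_atTop.2 fun b => ⟨(16 * b) ^ 2, fun n hn => ?_⟩
  rw [numRows, Nat.le_div_iff_mul_le (by norm_num), mul_comm]
  exact Nat.le_sqrt'.2 hn

/-- The factor `2` in the denominator of `lightWeight` halves the exponent here, so the union bound
against `2 ^ (-k)` still leaves `2 ^ (-k / 2)`. -/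
theorem card_ball_lightWeight_le (n : ℕ) :
    (ball n (lightWeight n)).card ≤ 4 * 2 ^ (numRows n / 2) := by
  refine (card_ball_le_of_lt_two_pow (Nat.lt_pow_succ_log_self one_lt_two n)).trans ?_
  refine Nat.mul_le_mul_left _ (Nat.pow_le_pow_right two_pos ?_)
  rw [lightWeight, ← Nat.div_div_eq_div_mul]
  exact Nat.mul_div_le _ _

theorem four_pow_mul_card_badRows_le {n kT j : ℕ} (hk : 4 ≤ numRows n) (hj : j ≤ 2 * numRows n)
    {g : Matrix (Fin j) (Fin n) (ZMod 2)} (hg : IsGeneric kT (n / 8) (lightWeight n) g) :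
    4 ^ numRows n * (badRows (n / 8) (lightWeight n) g).card ≤ (admissibleRows kT g).card := by
  set k := numRows n with hkdef
  set t := n / 8 with ht
  have hn : 256 * (k * k) ≤ n := sq_numRows_le n
  have ht8 : 32 * (k * k) ≤ t := by omega
  have hadm := two_pow_le_card_admissibleRows (admissibleRows_nonempty (kT := kT) hg.one_notMem)
  have hb1 : (ball n t).card ≤ 2 ^ (n - t) := card_ball_le_two_pow (by omega)
  have hb2 : (ball n (lightWeight n)).card ≤ 2 ^ k := by
    refine (card_ball_lightWeight_le n).trans ?_
    rw [show (4 : ℕ) = 2 ^ 2 from rfl, ← pow_add]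
    exact Nat.pow_le_pow_right two_pos (by omega)
  have hbad : (badRows t (lightWeight n) g).card ≤ 2 ^ (j + 2 + k + (j * j + 1) + (n - t)) := by
    refine hg.card_badRows_le.trans ?_
    calc _ ≤ 2 ^ (j + 1) * 2 ^ (n - t) + 2 ^ (j + 1) * 2 ^ k * (2 ^ (j * j + 1) * 2 ^ (n - t)) := by
          gcongr
      _ ≤ 2 ^ (j + 1 + k + (j * j + 1) + (n - t)) + 2 ^ (j + 1 + k + (j * j + 1) + (n - t)) := by
          rw [← pow_add, ← pow_add, ← pow_add, ← pow_add]
          refine add_le_add (Nat.pow_le_pow_right two_pos (by omega)) ?_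
          exact Nat.pow_le_pow_right two_pos (by omega)
      _ = _ := by ring
  refine Nat.le_of_mul_le_mul_right (hadm.trans' ?_) (by positivity : 0 < 2 ^ (j * j + 1))
  calc _ ≤ 4 ^ k * 2 ^ (j + 2 + k + (j * j + 1) + (n - t)) * 2 ^ (j * j + 1) := by gcongr
    _ = 2 ^ (2 * k + (j + 2 + k + (j * j + 1) + (n - t)) + (j * j + 1)) := by
        rw [show (4 : ℕ) = 2 ^ 2 from rfl, ← pow_mul, ← pow_add, ← pow_add]
    _ ≤ 2 ^ n := by
        -- The two terms `j * j` cost at most `8k²` and the rest is linear in `k`, while `t ≥ 32k²`.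
        refine Nat.pow_le_pow_right two_pos ?_
        have : j * j ≤ 4 * (k * k) := by nlinarith
        have : 4 * k ≤ k * k := Nat.mul_le_mul_right k hk
        omega

theorem toOuterMeasure_algorithm_goodMatrices_compl_le_pow {n : ℕ} (hk : 4 ≤ numRows n) :
    (algorithm n (numRows n) (numRows n + numRows n)).toOuterMeasure
        (some '' goodMatrices (numRows n) (n / 8) (lightWeight n))ᶜ ≤
      6 * (2⁻¹ : ℝ≥0∞) ^ (numRows n / 2) := by
  set k := numRows n with hkdef
  have hn : 256 * (k * k) ≤ n := sq_numRows_le n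
  have hkk : k ≤ k * k := Nat.le_mul_self k
  have hd : lightWeight n ≤ k := Nat.div_le_self _ _
  have h4 : (4 : ℝ≥0∞) = 2 * 2 := by norm_num
  have h2 : (2 : ℝ≥0∞)⁻¹ * 2 = 1 := ENNReal.inv_mul_cancel (by simp) (by simp)
  have hmono {a b : ℕ} (h : a ≤ b) : (2⁻¹ : ℝ≥0∞) ^ b ≤ 2⁻¹ ^ a :=
    pow_le_pow_right_of_le_one' (by simp) h
  refine (toOuterMeasure_algorithm_goodMatrices_compl_le (by omega) (by omega)
    ((2⁻¹ * 2⁻¹) ^ k) fun j hj g hg => ?_).trans ?_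
  · have h := four_pow_mul_card_badRows_le hk (by omega) hg
    have h' : (4 : ℝ≥0∞) ^ k * ((badRows (n / 8) (lightWeight n) g).card : ℝ≥0∞) ≤
      (admissibleRows k g).card := by exact_mod_cast h
    calc _ = (2⁻¹ * 2⁻¹) ^ k * (4 ^ k * ((badRows (n / 8) (lightWeight n) g).card : ℝ≥0∞)) := by
          rw [← mul_assoc, ← mul_pow, h4, mul_mul_mul_comm, h2, one_mul, one_pow, one_mul]
      _ ≤ _ := by gcongr
  · have e1 : ((k + k : ℕ) : ℝ≥0∞) * (2⁻¹ * 2⁻¹) ^ k ≤ 2 * 2⁻¹ ^ (k / 2) := by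
      have hk2 : ((k + k : ℕ) : ℝ≥0∞) ≤ 2 * 2 ^ k := by
        have : k + k ≤ 2 * 2 ^ k := by have := Nat.lt_two_pow_self (n := k); omega
        exact_mod_cast this
      calc _ ≤ 2 * (2 : ℝ≥0∞) ^ k * (2⁻¹ * 2⁻¹) ^ k := by gcongr
        _ = 2 * (2⁻¹ * 2) ^ k * 2⁻¹ ^ k := by rw [mul_pow, mul_pow]; ring
        _ = 2 * 2⁻¹ ^ k := by rw [h2, one_pow, mul_one]
        _ ≤ _ := by
            gcongr 2 * ?_
            exact hmono (Nat.div_le_self _ _)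
    have e2 : ((ball n (lightWeight n)).card : ℝ≥0∞) * 2⁻¹ ^ k ≤ 4 * 2⁻¹ ^ (k / 2) := by
      have hb : ((ball n (lightWeight n)).card : ℝ≥0∞) ≤ 4 * 2 ^ (k / 2) := by
        exact_mod_cast card_ball_lightWeight_le n
      calc _ ≤ 4 * (2 : ℝ≥0∞) ^ (k / 2) * 2⁻¹ ^ (k / 2 + k / 2) := by
            gcongr ?_ * ?_
            exact hmono (by omega)
        _ = 4 * (2⁻¹ * 2) ^ (k / 2) * 2⁻¹ ^ (k / 2) := by rw [mul_pow, pow_add]; ring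
        _ = _ := by rw [h2, one_pow, mul_one]
    calc _ ≤ 2 * 2⁻¹ ^ (k / 2) + 4 * 2⁻¹ ^ (k / 2) := add_le_add e1 e2
      _ = _ := by rw [← add_mul]; norm_num

theorem tendsto_toOuterMeasure_goodMatrices :
    Tendsto (fun n => (algorithm n (numRows n) (numRows n + numRows n)).toOuterMeasure
      (some '' goodMatrices (numRows n) (n / 8) (lightWeight n))) atTop (𝓝 1) := by
  have hlim : Tendsto (fun n => 1 - 6 * (2⁻¹ : ℝ≥0∞) ^ (numRows n / 2)) atTop (𝓝 1) := by
    have h := ((ENNReal.tendsto_pow_atTop_nhds_zero_of_lt_one (r := 2⁻¹) (by simp)).comp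
      ((Nat.tendsto_div_const_atTop two_ne_zero).comp tendsto_numRows))
    have h' := ENNReal.Tendsto.const_mul (a := 6) h (Or.inr (by simp))
    have h'' := ENNReal.Tendsto.sub (tendsto_const_nhds (x := (1 : ℝ≥0∞))) h' (Or.inl (by simp))
    simpa using h''
  refine tendsto_of_tendsto_of_tendsto_of_le_of_le' hlim tendsto_const_nhds ?_
    (Eventually.of_forall fun n => toOuterMeasure_le_one _ _)
  filter_upwards [tendsto_numRows.eventually_ge_atTop 4] with n hn
  refine tsub_le_iff_right.2 ?_
  set p := algorithm n (numRows n) (numRows n + numRows n)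
  set S := some '' goodMatrices (m := numRows n + numRows n) (n := n) (numRows n) (n / 8)
    (lightWeight n)
  calc 1 = p.toOuterMeasure (S ∪ Sᶜ) := by
        rw [Set.union_compl_self, eq_comm, PMF.toOuterMeasure_apply_eq_one_iff]
        exact Set.subset_univ _
    _ ≤ p.toOuterMeasure S + p.toOuterMeasure Sᶜ := MeasureTheory.measure_union_le _ _
    _ ≤ _ := by
        gcongr
        exact toOuterMeasure_algorithm_goodMatrices_compl_le_pow hn

/-! ### Asymptotics -/

theorem numRows_le_sqrt (n : ℕ) : 16 * (numRows n : ℝ) ≤ √n := by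
  refine Real.le_sqrt_of_sq_le ?_
  have h : (256 * (numRows n * numRows n) : ℝ) ≤ n := by exact_mod_cast sq_numRows_le n
  linarith

theorem sqrt_le_numRows {n : ℕ} (h : 1 ≤ numRows n) : √n ≤ 32 * (numRows n : ℝ) := by
  refine Real.sqrt_le_left (by positivity) |>.mpr ?_
  have h : (n : ℝ) ≤ 1024 * (numRows n * numRows n) := by exact_mod_cast le_sq_numRows h
  linarith

theorem isTheta_numRows : (fun n => (numRows n : ℝ)) =Θ[atTop] fun n : ℕ => √(n : ℝ) := by
  refine ⟨IsBigO.of_bound 1 (Eventually.of_forall fun n => ?_), IsBigO.of_bound 32 ?_⟩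
  · rw [Real.norm_of_nonneg (by positivity), Real.norm_of_nonneg (by positivity)]
    have := numRows_le_sqrt n
    have : (0 : ℝ) ≤ numRows n := by positivity
    linarith
  · filter_upwards [tendsto_numRows.eventually_ge_atTop 1] with n hn
    rw [Real.norm_of_nonneg (by positivity), Real.norm_of_nonneg (by positivity)]
    exact sqrt_le_numRows hn

/-- Here `192 = 32 * 2 * 3`, from `√n ≤ 32k`, the `2` in `lightWeight`, and `Nat.log 2 n + 1 ≤ 3 *
Real.log n`. -/
theorem sqrt_div_log_le {n D : ℕ} (hk : 1 ≤ numRows n) (hx : 1 ≤ Real.log n)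
    (hD : lightWeight n < D) : 1 / 192 * (√n / Real.log n) ≤ D := by
  have h1 : numRows n < 2 * (Nat.log 2 n + 1) * (lightWeight n + 1) :=
    Nat.lt_mul_div_succ _ (by positivity)
  have h2 : numRows n ≤ 2 * (Nat.log 2 n + 1) * D :=
    h1.le.trans (Nat.mul_le_mul_left _ hD)
  have h3 : (numRows n : ℝ) ≤ 2 * (Nat.log 2 n + 1) * D := by exact_mod_cast h2
  have h4 : (Nat.log 2 n : ℝ) ≤ 2 * Real.log n := by
    refine (Real.natLog_le_logb n 2).trans ?_
    rw [Real.logb, div_le_iff₀ (Real.log_pos (by norm_num))]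
    have := Real.log_two_gt_d9
    push_cast
    nlinarith
  have h5 := sqrt_le_numRows hk
  rw [one_div_mul_eq_div, div_div, div_le_iff₀ (by positivity)]
  have h6 : (Nat.log 2 n + 1 : ℝ) * D ≤ 3 * Real.log n * D := by
    gcongr; linarith
  linarith

/-- With `x = log n`, the numerator of `γ` lies in `[x/2, x/2 + log 32]` and the denominator in
`[x/2 - log 192 - log x, x/2]`. In particular `γ ≥ 1`. -/
theorem eventually_abs_efficiency_sub_one_lt {ε : ℝ} (hε : 0 < ε) :
    ∀ᶠ n : ℕ in atTop, ∀ D : ℕ, lightWeight n < D → D ≤ numRows n + numRows n →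
      |efficiency n (numRows n) D - 1| < ε := by
  have hx : Tendsto (fun n : ℕ => Real.log n) atTop atTop :=
    Real.tendsto_log_atTop.comp tendsto_natCast_atTop_atTop
  -- The available budget is `ε * x / 2`. This constant gives half of it to `(1 + ε) * log x`; the
  -- threshold on `x` below gives the other half to the constant terms.
  have hlog : ∀ᶠ x : ℝ in atTop, Real.log x ≤ ε / (4 * (1 + ε)) * x := by
    have h := Real.isLittleO_log_id_atTop.bound (c := ε / (4 * (1 + ε))) (by positivity)
    filter_upwards [h, eventually_ge_atTop 0] with x hx hx0
    rw [id, Real.norm_of_nonneg hx0] at hx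
    exact (Real.le_norm_self _).trans hx
  filter_upwards [tendsto_numRows.eventually_ge_atTop 1, hx.eventually_ge_atTop 1,
    hx.eventually hlog,
    hx.eventually_gt_atTop (4 * (Real.log 32 + (1 + ε) * Real.log 192) / ε)] with n hk h1 h2 h3
  intro D hD hD'
  set x := Real.log n with hxdef
  have hkpos : (0 : ℝ) < numRows n := by exact_mod_cast hk
  have hs0 : 0 < √(n : ℝ) := by linarith [numRows_le_sqrt n]
  have hn0 : (0 : ℝ) < n := Real.sqrt_pos.1 hs0
  have hsq : √(n : ℝ) * √(n : ℝ) = n := Real.mul_self_sqrt hn0.le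
  have hls : Real.log √(n : ℝ) = x / 2 := Real.log_sqrt hn0.le
  have hD0 : (0 : ℝ) < D := by exact_mod_cast (Nat.zero_le _).trans_lt hD
  have hDle : (D : ℝ) ≤ √n := by
    have : (D : ℝ) ≤ numRows n + numRows n := by exact_mod_cast hD'
    linarith [numRows_le_sqrt n]
  have hA1 : x / 2 ≤ Real.log (n / numRows n) := by
    rw [← hls]
    refine Real.log_le_log hs0 ((le_div_iff₀ hkpos).2 ?_)
    nlinarith [numRows_le_sqrt n]
  have hA2 : Real.log (n / numRows n) ≤ Real.log 32 + x / 2 := by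
    rw [← hls, ← Real.log_mul (by norm_num) hs0.ne']
    refine Real.log_le_log (by positivity) ((div_le_iff₀ hkpos).2 ?_)
    nlinarith [sqrt_le_numRows hk]
  have hB1 : Real.log D ≤ x / 2 := by
    rw [← hls]
    exact Real.log_le_log hD0 hDle
  have hB2 : x / 2 - Real.log 192 - Real.log x ≤ Real.log D := by
    have h := Real.log_le_log (by positivity) (sqrt_div_log_le hk h1 hD)
    rw [Real.log_mul (by norm_num) (by positivity), Real.log_div hs0.ne' (by positivity), hls,
      one_div, Real.log_inv] at h
    linarith
  have hlx : 0 ≤ Real.log x := Real.log_nonneg h1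
  have hl32 : 0 < Real.log 32 := Real.log_pos (by norm_num)
  have hl192 : 0 < Real.log 192 := Real.log_pos (by norm_num)
  have key : Real.log 32 + Real.log 192 + Real.log x < ε * (x / 2 - Real.log 192 - Real.log x) := by
    rw [div_lt_iff₀ hε] at h3
    have : (1 + ε) * Real.log x ≤ ε * x / 4 := by
      calc _ ≤ (1 + ε) * (ε / (4 * (1 + ε)) * x) := by gcongr
        _ = _ := by field_simp
    linarith
  have hkey : Real.log 32 + Real.log 192 + Real.log x < ε * Real.log D :=
    key.trans_le (by gcongr)
  have hB0 : 0 < Real.log D := by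
    by_contra! h
    have := mul_nonpos_of_nonneg_of_nonpos hε.le h
    linarith
  rw [efficiency, div_sub_one hB0.ne', abs_of_nonneg (div_nonneg (by linarith) hB0.le),
    div_lt_iff₀ hB0]
  linarith

end RandTri

theorem mainTheorem1 :
    ∃ m k₀ kT : ℕ → ℕ,
      (∀ n, m n = k₀ n + kT n) ∧
      (fun n => (m n : ℝ)) =Θ[atTop] (fun n : ℕ => Real.sqrt n) ∧
      (fun n => (k₀ n : ℝ)) =Θ[atTop] (fun n : ℕ => Real.sqrt n) ∧
      (fun n => (kT n : ℝ)) =Θ[atTop] (fun n : ℕ => Real.sqrt n) ∧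
      ∃ C : ℝ, 0 < C ∧ ∀ ε : ℝ, 0 < ε →
        Tendsto
          (fun n : ℕ => (RandTri.algorithm n (kT n) (m n)).toOuterMeasure
            {o | ∃ G : Matrix (Fin (m n)) (Fin n) (ZMod 2), o = some G ∧
              RandTri.IsTriorthogonal (kT n) G ∧
              C * (Real.sqrt n / Real.log n) ≤ (RandTri.distance G : ℝ) ∧
              |RandTri.efficiency n (kT n) (RandTri.distance G) - 1| < ε})
          atTop (𝓝 1) := by
  refine ⟨fun n => RandTri.numRows n + RandTri.numRows n, RandTri.numRows, RandTri.numRows,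
    fun _ => rfl, ?_, RandTri.isTheta_numRows, RandTri.isTheta_numRows, 1 / 192, by norm_num,
    fun ε hε => ?_⟩
  · simp_rw [Nat.cast_add, ← two_mul]
    exact RandTri.isTheta_numRows.const_mul_left two_ne_zero
  refine tendsto_of_tendsto_of_tendsto_of_le_of_le' RandTri.tendsto_toOuterMeasure_goodMatrices
    tendsto_const_nhds ?_ (Eventually.of_forall fun n => RandTri.toOuterMeasure_le_one _ _)
  filter_upwards [RandTri.tendsto_numRows.eventually_ge_atTop 1,
    (Real.tendsto_log_atTop.comp tendsto_natCast_atTop_atTop).eventually_ge_atTop 1,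
    RandTri.eventually_abs_efficiency_sub_one_lt hε] with n hk hx heff
  refine MeasureTheory.measure_mono ?_
  rintro _ ⟨G, hG, rfl⟩
  have hlt := RandTri.lt_distance_of_mem_goodMatrices hG (by omega) (by omega)
  have hle := hG.1.triorthogonal.distance_le (by omega) (by omega)
  exact ⟨G, rfl, hG.1.triorthogonal, RandTri.sqrt_div_log_le hk hx hlt, heff _ hlt hle⟩
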